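/- Let $(S,\cdot)$ be a finite semigroup and let $N=\lceil(6|S|+2)\log_2|S|\rceil$ (with $N=0$ if $S=\emptyset$). There is a family $(\mathrm{labelling}_a(x,y))_{a\in S}$ of first-order formulae, whose free variables are among $x,y$, over the signature consisting of a binary relation $<$ and $N$ unary predicates $p_1,\dots,p_N$ (equality being allowed), such that the following holds. Call a linear ordering complete if every nonempty subset with an upper bound has a least upper bound and every nonempty subset with a lower bound has a greatest lower bound; call a map $\sigma$ from the pairs $(x,y)$ of elements of $\alpha$ with $x<y$ to $S$ an additive labelling from $\alpha$ to $S$ if $\sigma(x,y)\cdot\sigma(y,z)=\sigma(x,z)$ for all $x<y<z$ in $\alpha$. Then for every complete linear ordering $\alpha$ and every additive labelling $\sigma$ from $\alpha$ to $S$ there exist subsets $X_1,\dots,X_N$ of $\alpha$ such that for all $a\in S$ and all $x<y$ in $\alpha$, $$\sigma(x,y)=a\quad\text{if and only if}\quad(\alpha,X_1,\dots,X_N)\models\mathrm{labelling}_a(x,y),$$ where $<$ is interpreted as the ordering of $\alpha$ and each $p_i$ as $X_i$. -/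

import Mathlib

open FirstOrder

/-- A linear ordering is *complete* if every nonempty subset with an upper bound has a least
upper bound, and every nonempty subset with a lower bound has a greatest lower bound. -/
def IsCompleteOrdering (α : Type*) [LinearOrder α] : Prop :=
  (∀ A : Set α, A.Nonempty → BddAbove A → ∃ b, IsLUB A b) ∧
  (∀ A : Set α, A.Nonempty → BddBelow A → ∃ b, IsGLB A b)

/-- An *additive labelling* from `α` to `S`: a map defined on the pairs `x < y` of `α` such that
`σ(x,y) · σ(y,z) = σ(x,z)` for all `x < y < z`. -/
def IsAdditiveLabelling {α S : Type*} [LinearOrder α] [Semigroup S]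
    (σ : ∀ x y : α, x < y → S) : Prop :=
  ∀ (x y z : α) (hxy : x < y) (hyz : y < z),
    σ x y hxy * σ y z hyz = σ x z (hxy.trans hyz)

/-- The relation names: a binary one for the strict ordering, and `N` unary predicates. -/
inductive LabelledOrderRel (N : ℕ) : ℕ → Type
  | lt : LabelledOrderRel N 2
  | pred (i : Fin N) : LabelledOrderRel N 1

/-- The relational signature consisting of `<` and of `N` unary predicates (equality is
part of first-order logic). -/
abbrev labelledOrderLanguage (N : ℕ) : Language :=
  ⟨fun _ => Empty, LabelledOrderRel N⟩

/-- The relational structure `(α, X₁, …, X_N)`: the universe is `α`, the binary symbol is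
interpreted as the strict ordering of `α`, and the `i`-th predicate as the set `X i`. -/
@[reducible] def labelledOrderStructure {N : ℕ} {α : Type*} [LinearOrder α] (X : Fin N → Set α) :
    (labelledOrderLanguage N).Structure α where
  funMap := fun f => nomatch f
  RelMap := fun R v =>
    match R, v with
    | .lt, v => v 0 < v 1
    | .pred i, v => v 0 ∈ X i

/-- `(α, X₁, …, X_N) ⊨ φ(x, y)`, for a first-order formula `φ` whose free variables are among
two variables, the first one taking the value `x` and the second one the value `y`. -/
def LabelledOrderModels {N : ℕ} {α : Type*} [LinearOrder α] (X : Fin N → Set α)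
    (φ : (labelledOrderLanguage N).Formula (Fin 2)) (x y : α) : Prop :=
  @Language.Formula.Realize (labelledOrderLanguage N) α (labelledOrderStructure X) (Fin 2) φ ![x, y]

/-- The number `⌈(6n + 2) log₂ n⌉` of unary predicates used for a semigroup with `n` elements. -/
noncomputable def compactionSize (n : ℕ) : ℕ :=
  ⌈(6 * (n : ℝ) + 2) * Real.logb 2 (n : ℝ)⌉₊

/-! Adjoin a unit to `S` to get a finite monoid `M`. The core is a Ramsey-type statement,
`exists_split`: the points of any labelled ordering can be given boundedly many levels so that two
points of level k with no higher level between them are always labelled by one element e k. The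
values e depend on `M` alone, so fixed formulae can mention them.

Splits are built one J-class at a time, starting from a maximal one J. A maximal set of points whose
mutual labels avoid J is handled by recursion and put on top. Every other point sees a point of this
skeleton through a label in J, and stability confines the label between two such points of equal
colour to one H-class, where it is an idempotent and hence unique.

Given a split, the label of (x, y) is recovered by recursion on a bound for the levels strictly
between (`segmentValue_iff`): go from x to the points of top level k, cross them with value e k, go
on to y. Completeness supplies the infimum and supremum of these points. When these are not
attained, two elements of `M` stored at each point, `R` and `L`, give the label from the limit to
nearby points of level k. The recursion is first-order in the level, `R` and `L`, and these finitely
many colours are written in binary with the N predicates. -/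

/-- The two-sided ideal generated by an element of a monoid. -/
def principalIdeal {M : Type*} [Monoid M] (t : M) : Set M :=
  {s | ∃ a b, s = a * t * b}

/-! ### Green's relations in finite monoids. -/

section Stability

variable {M : Type*} [Monoid M]

theorem mem_principalIdeal_self (t : M) : t ∈ principalIdeal t := ⟨1, 1, by simp⟩

theorem mul_mem_principalIdeal_left (s t : M) : s * t ∈ principalIdeal s := ⟨1, t, by simp⟩

theorem mul_mem_principalIdeal_right (s t : M) : s * t ∈ principalIdeal t := ⟨s, 1, by simp⟩

theorem principalIdeal_subset_iff {s t : M} :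
    principalIdeal s ⊆ principalIdeal t ↔ s ∈ principalIdeal t := by
  refine ⟨fun h => h (mem_principalIdeal_self s), ?_⟩
  rintro ⟨a, b, rfl⟩ _ ⟨c, d, rfl⟩
  exact ⟨c * a, b * d, by simp only [mul_assoc]⟩

theorem exists_mul_pow_add_eq [Finite M] (w b : M) :
    ∃ i p, w * b ^ (i + (p + 1)) = w * b ^ i := by
  obtain ⟨i, j, hne, h⟩ := Finite.exists_ne_map_eq_of_infinite (fun i : ℕ => w * b ^ i)
  rcases lt_or_gt_of_ne hne with hlt | hlt
  · exact ⟨i, j - i - 1, by rw [h]; congr 2; omega⟩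
  · exact ⟨j, i - j - 1, by rw [← h]; congr 2; omega⟩

/-- If `w = a * w * b` in a finite monoid, some positive power of `a` fixes `w`. -/
theorem exists_pow_mul_eq_self [Finite M] {w a b : M} (h : w = a * w * b) :
    ∃ p, a ^ (p + 1) * w = w := by
  have hpow : ∀ k, w = a ^ k * w * b ^ k := by
    intro k
    induction k with
    | zero => simp
    | succ k ih =>
      calc w = a ^ k * (a * w * b) * b ^ k := by rw [← h]; exact ih
        _ = a ^ (k + 1) * w * b ^ (k + 1) := by
          rw [pow_succ, pow_succ']; simp only [mul_assoc]
  -- The orbit of `w` under `b` is eventually periodic; the decomposition `hpow` transfers the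
  -- period to the powers of `a`.
  obtain ⟨i, p, hi⟩ := exists_mul_pow_add_eq w b
  refine ⟨p, ?_⟩
  calc a ^ (p + 1) * w = a ^ (p + 1) * (a ^ i * w * b ^ i) := by rw [← hpow i]
    _ = a ^ (p + 1) * a ^ i * (w * b ^ i) := by simp only [mul_assoc]
    _ = a ^ (i + (p + 1)) * w * b ^ (i + (p + 1)) := by
      rw [← pow_add, ← hi, add_comm (p + 1) i]; simp only [mul_assoc]
    _ = w := (hpow _).symm

theorem exists_mul_pow_eq_self [Finite M] {w a b : M} (h : w = a * w * b) :
    ∃ p, w * b ^ (p + 1) = w := by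
  have h' : MulOpposite.op w = MulOpposite.op b * MulOpposite.op w * MulOpposite.op a := by
    rw [← MulOpposite.op_mul, ← MulOpposite.op_mul, ← mul_assoc, ← h]
  have : Finite Mᵐᵒᵖ := Finite.of_equiv M MulOpposite.opEquiv
  obtain ⟨p, hp⟩ := exists_pow_mul_eq_self h'
  exact ⟨p, by rwa [← MulOpposite.op_pow, ← MulOpposite.op_mul, MulOpposite.op_inj] at hp⟩

/-- Stability of finite monoids, left version. -/
theorem exists_left_mul_eq_self [Finite M] {w c : M} (h : w ∈ principalIdeal (c * w)) :
    ∃ d, w = d * (c * w) := by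
  obtain ⟨a, b, hab⟩ := h
  obtain ⟨p, hp⟩ := exists_pow_mul_eq_self (w := w) (a := a * c) (b := b)
    (by simpa only [mul_assoc] using hab)
  exact ⟨(a * c) ^ p * a, by rw [pow_succ] at hp; simpa only [mul_assoc] using hp.symm⟩

/-- Stability of finite monoids, right version. -/
theorem exists_right_mul_eq_self [Finite M] {w c : M} (h : w ∈ principalIdeal (w * c)) :
    ∃ d, w = w * c * d := by
  obtain ⟨a, b, hab⟩ := h
  obtain ⟨p, hp⟩ := exists_mul_pow_eq_self (w := w) (a := a) (b := c * b)
    (by simpa only [mul_assoc] using hab)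
  exact ⟨b * (c * b) ^ p, by rw [pow_succ'] at hp; simpa only [mul_assoc] using hp.symm⟩

end Stability

/-! ### Splits of bounded height with uniform values. -/

/-- A maximal set of points whose mutual labels avoid `J`. -/
theorem exists_maximal_avoiding {α M : Type*} [LinearOrder α] (f : α → α → M) (J : Set M) :
    ∃ β : Set α, (∀ x ∈ β, ∀ y ∈ β, x < y → f x y ∉ J) ∧
      ∀ x ∉ β, (∃ b ∈ β, b < x ∧ f b x ∈ J) ∨ ∃ b ∈ β, x < b ∧ f x b ∈ J := by
  obtain ⟨β, hβ⟩ := zorn_subset {β : Set α | ∀ x ∈ β, ∀ y ∈ β, x < y → f x y ∉ J} (by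
    intro c hc hchain
    refine ⟨⋃₀ c, ?_, fun s hs => Set.subset_sUnion_of_mem hs⟩
    rintro x ⟨s, hs, hx⟩ y ⟨t, ht, hy⟩ hxy
    rcases hchain.total hs ht with h | h
    · exact hc ht x (h hx) y hy hxy
    · exact hc hs x hx y (h hy) hxy)
  refine ⟨β, hβ.prop, fun x hx => ?_⟩
  by_contra! hcon
  refine hx (hβ.le_of_ge (y := insert x β) ?_ (Set.subset_insert _ _) (Set.mem_insert _ _))
  rintro a (rfl | ha) b (rfl | hb) hab
  · exact absurd hab (lt_irrefl _)
  · exact hcon.2 b hb hab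
  · exact hcon.1 a ha hab
  · exact hβ.prop a ha b hb hab

section Split

variable {M : Type*} [Monoid M]

/-- `w` fixes `u` on the right and lies in the meet of the left class of `u` with the right class
of `v`: at most one `w` does, see `IsUpValue.unique`. -/
def IsUpValue (u v w : M) : Prop :=
  u * w = u ∧ (∃ p, w = p * u) ∧ (∃ q, w = v * q) ∧ ∃ q, v = w * q

/-- The mirror image of `IsUpValue`. -/
def IsDownValue (u v w : M) : Prop :=
  w * u = u ∧ (∃ p, w = u * p) ∧ (∃ q, w = q * v) ∧ ∃ q, v = q * w

/-- Such elements are idempotent, since they are left multiples of `u` and fix `u` on the right.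
L-equivalent idempotents satisfy w'w = w', R-equivalent ones w'w = w. -/
theorem IsUpValue.unique {u v w w' : M} (h : IsUpValue u v w) (h' : IsUpValue u v w') :
    w = w' := by
  obtain ⟨h1, ⟨p, hp⟩, ⟨q, hq⟩, -⟩ := h
  obtain ⟨h1', ⟨p', hp'⟩, -, ⟨r', hr'⟩⟩ := h'
  have e1 : w * w' = w := by rw [hp, mul_assoc, h1']
  have e2 : w' * w' = w' := by
    nth_rw 1 [hp']; rw [mul_assoc, h1', ← hp']
  have e3 : w' * w = w := by
    rw [hq, hr', ← mul_assoc, ← mul_assoc, e2]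
  have e4 : w' * w = w' := by
    nth_rw 1 [hp']; rw [mul_assoc, h1, ← hp']
  rw [← e4, e3]

theorem IsDownValue.unique {u v w w' : M} (h : IsDownValue u v w) (h' : IsDownValue u v w') :
    w = w' := by
  obtain ⟨h1, ⟨p, hp⟩, ⟨q, hq⟩, -⟩ := h
  obtain ⟨h1', ⟨p', hp'⟩, -, ⟨r', hr'⟩⟩ := h'
  have e2 : w' * w' = w' := by
    nth_rw 2 [hp']; rw [← mul_assoc, h1', ← hp']
  have e3 : w * w' = w := by
    rw [hq, hr', mul_assoc, mul_assoc, e2]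
  have e4 : w * w' = w' := by
    conv_lhs => rw [hp', ← mul_assoc, h1, ← hp']
  rw [← e4, e3]

/-- The element of the monoid that the colour of a point outside the skeleton determines. -/
theorem exists_colour_value : ∃ g : Bool × M × M → M,
    (∀ u v w, IsUpValue u v w → g (true, u, v) = w) ∧
    (∀ u v w, IsDownValue u v w → g (false, u, v) = w) := by
  classical
  refine ⟨fun c => if h : ∃ w, (if c.1 then IsUpValue c.2.1 c.2.2 w
    else IsDownValue c.2.1 c.2.2 w) then h.choose else 1, ?_, ?_⟩
  · intro u v w hw
    have h : ∃ w, IsUpValue u v w := ⟨w, hw⟩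
    simp only [if_true, h, dif_pos]
    exact h.choose_spec.unique hw
  · intro u v w hw
    have h : ∃ w, IsDownValue u v w := ⟨w, hw⟩
    simp only [Bool.false_eq_true, if_false, h, dif_pos]
    exact h.choose_spec.unique hw

/-- The levels of a point set `α` labelled by `f` form a split with values `e`: two points of the
same level not separated by a higher level are labelled by the value of their level. -/
def IsSplit {α : Type*} [LinearOrder α] (f : α → α → M) (e : ℕ → M) (s : α → ℕ) : Prop :=
  ∀ x y, x < y → s x = s y → (∀ z, x < z → z < y → s z ≤ s x) → f x y = e (s x)

variable [Finite M]

/-- Induction on the set `T` of allowed labels: each round removes at least one element, by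
discarding a whole J-class, and costs 2|M|² levels. Choosing `e` before the ordering is what makes
the final formulae uniform. -/
theorem exists_split_aux (n : ℕ) : ∀ T : Finset M, T.card = n → ∃ e : ℕ → M,
    ∀ (α : Type*) [LinearOrder α] (f : α → α → M),
      (∀ x y z, x < y → y < z → f x y * f y z = f x z) → (∀ x y, x < y → f x y ∈ T) →
      ∃ s : α → ℕ, (∀ x, s x ≤ 2 * Nat.card M ^ 2 * T.card) ∧ IsSplit f e s := by
  classical
  induction n using Nat.strong_induction_on with
  | _ n ih =>
  intro T hT
  rcases T.eq_empty_or_nonempty with rfl | hne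
  · exact ⟨fun _ => 1, fun α _ f _ hf => ⟨fun _ => 0, by simp, fun x y hxy => by
      simpa using hf x y hxy⟩⟩
  obtain ⟨m, hmT, hmax⟩ := T.exists_maximalFor principalIdeal hne
  set J : Set M := {t | principalIdeal t = principalIdeal m} with hJ
  -- By maximality of J, factors of an element of J that lie in `T` are again in J.
  have hup : ∀ s ∈ T, ∀ t ∈ J, t ∈ principalIdeal s → s ∈ J := by
    intro s hs t ht hts
    have h1 : principalIdeal m ⊆ principalIdeal s := by
      rw [← show principalIdeal t = principalIdeal m from ht]
      exact principalIdeal_subset_iff.2 hts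
    exact (hmax hs h1).antisymm h1
  have hJJ : ∀ s ∈ J, ∀ t ∈ J, s ∈ principalIdeal t := by
    intro s hs t ht
    rw [← principalIdeal_subset_iff]
    exact (hs.trans ht.symm).subset
  have hcard : (T.filter (· ∉ J)).card < T.card :=
    Finset.card_lt_card (Finset.filter_ssubset.2 ⟨m, hmT, by simp [hJ]⟩)
  obtain ⟨e', he'⟩ := ih _ (hT ▸ hcard) _ rfl
  obtain ⟨g, hgu, hgd⟩ := exists_colour_value (M := M)
  set d := 2 * Nat.card M ^ 2 with hd
  -- A colour records on which side the chosen skeleton point lies, the label to or from it, and a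
  -- representative of the R-class or L-class of the labels in J on the other side. Colours are the
  -- levels below `d`; the recursive levels are shifted by `d`.
  have hcardK : Nat.card (Bool × M × M) = d := by
    simp [Nat.card_prod, hd, sq]
  let enc : Bool × M × M → ℕ := fun c => (Finite.equivFinOfCardEq hcardK c : ℕ)
  have henc : Function.Injective enc := fun a b h =>
    (Finite.equivFinOfCardEq hcardK).injective (Fin.ext h)
  have hencd : ∀ c, enc c < d := fun c => (Finite.equivFinOfCardEq hcardK c).2
  refine ⟨fun i => if i < d then Function.extend enc g (fun _ => 1) i else e' (i - d), ?_⟩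
  intro α _ f hadd hfT
  have hsub : ∀ x x' y' y, x ≤ x' → x' < y' → y' ≤ y → f x y ∈ J → f x' y' ∈ J := by
    intro x x' y' y h1 h2 h3 hxy
    have h4 : f x' y ∈ J := by
      rcases h1.eq_or_lt with rfl | h1
      · exact hxy
      · refine hup _ (hfT _ _ (h2.trans_le h3)) _ hxy ?_
        rw [← hadd x x' y h1 (h2.trans_le h3)]
        exact mul_mem_principalIdeal_right _ _
    rcases h3.eq_or_lt with rfl | h3
    · exact h4
    · refine hup _ (hfT _ _ h2) _ h4 ?_
      rw [← hadd x' y' y h2 h3]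
      exact mul_mem_principalIdeal_left _ _
  have hR : ∀ x y y', x < y → x < y' → f x y ∈ J → f x y' ∈ J → ∃ q, f x y = f x y' * q := by
    intro x y y' hy hy' hJy hJy'
    rcases lt_trichotomy y y' with h | rfl | h
    · rw [← hadd x y y' hy h] at hJy' ⊢
      exact exists_right_mul_eq_self (hJJ _ hJy _ hJy')
    · exact ⟨1, by simp⟩
    · exact ⟨f y' y, (hadd _ _ _ hy' h).symm⟩
  have hL : ∀ x x' y, x < y → x' < y → f x y ∈ J → f x' y ∈ J → ∃ q, f x y = q * f x' y := by
    intro x x' y hx hx' hJx hJx'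
    rcases lt_trichotomy x x' with h | rfl | h
    · exact ⟨f x x', (hadd _ _ _ h hx').symm⟩
    · exact ⟨1, by simp⟩
    · rw [← hadd x' x y h hx] at hJx' ⊢
      exact exists_left_mul_eq_self (hJJ _ hJx _ hJx')
  obtain ⟨β, hβ, hβmax⟩ := exists_maximal_avoiding f J
  obtain ⟨s', hs'le, hs'⟩ := he' β (fun x y => f x y)
    (fun x y z hxy hyz => hadd x y z hxy hyz)
    (fun x y hxy => Finset.mem_filter.2 ⟨hfT _ _ hxy, hβ x x.2 y y.2 hxy⟩)
  -- By `hR` and `hL` the choice does not affect the R-class or L-class; the default 1 is never used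
  -- in a comparison.
  let vR : α → M := fun x => if h : ∃ y, x < y ∧ f x y ∈ J then f x h.choose else 1
  let vL : α → M := fun y => if h : ∃ x, x < y ∧ f x y ∈ J then f h.choose y else 1
  have hvR : ∀ x y, x < y → f x y ∈ J → ∃ y', x < y' ∧ f x y' ∈ J ∧ vR x = f x y' := by
    intro x y hxy hJy
    have h : ∃ y, x < y ∧ f x y ∈ J := ⟨y, hxy, hJy⟩
    exact ⟨h.choose, h.choose_spec.1, h.choose_spec.2, dif_pos h⟩
  have hvL : ∀ x y, x < y → f x y ∈ J → ∃ x', x' < y ∧ f x' y ∈ J ∧ vL y = f x' y := by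
    intro x y hxy hJy
    have h : ∃ x, x < y ∧ f x y ∈ J := ⟨x, hxy, hJy⟩
    exact ⟨h.choose, h.choose_spec.1, h.choose_spec.2, dif_pos h⟩
  have hcol : ∀ x, x ∉ β → ∃ c : Bool × M × M,
      (∃ b ∈ β, b < x ∧ f b x ∈ J ∧ c = (true, f b x, vR x)) ∨
      (∃ b ∈ β, x < b ∧ f x b ∈ J ∧ c = (false, f x b, vL x)) := by
    intro x hx
    rcases hβmax x hx with ⟨b, hb, hbx, hbJ⟩ | ⟨b, hb, hbx, hbJ⟩
    · exact ⟨_, .inl ⟨b, hb, hbx, hbJ, rfl⟩⟩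
    · exact ⟨_, .inr ⟨b, hb, hbx, hbJ, rfl⟩⟩
  choose! c hc using hcol
  let s : α → ℕ := fun x => if hx : x ∈ β then d + s' ⟨x, hx⟩ else enc (c x)
  have hsβ : ∀ x (hx : x ∈ β), s x = d + s' ⟨x, hx⟩ := fun x hx => dif_pos hx
  have hsn : ∀ x, x ∉ β → s x = enc (c x) := fun x hx => dif_neg hx
  refine ⟨s, fun x => ?_, fun x y hxy hs hz => ?_⟩
  · by_cases hx : x ∈ β
    · rw [hsβ x hx]
      calc d + s' ⟨x, hx⟩ ≤ d + d * (T.filter (· ∉ J)).card := by gcongr; exact hs'le _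
        _ = d * ((T.filter (· ∉ J)).card + 1) := by ring
        _ ≤ d * T.card := by gcongr; exact hcard
    · rw [hsn x hx]
      exact (hencd _).le.trans (Nat.le_mul_of_pos_right _ hne.card_pos)
  by_cases hx : x ∈ β <;> by_cases hy : y ∈ β
  · simp only
    rw [hsβ x hx, if_neg (Nat.not_lt.2 (Nat.le_add_right _ _)), Nat.add_sub_cancel_left]
    rw [hsβ x hx, hsβ y hy] at hs
    refine hs' ⟨x, hx⟩ ⟨y, hy⟩ hxy (by omega) fun z hxz hzy => ?_
    have := hz z hxz hzy
    rw [hsβ z z.2, hsβ x hx] at this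
    exact Nat.le_of_add_le_add_left this
  · rw [hsβ x hx, hsn y hy] at hs
    have := hencd (c y)
    omega
  · rw [hsβ y hy, hsn x hx] at hs
    have := hencd (c x)
    omega
  simp only
  rw [hsn x hx, if_pos (hencd _), henc.extend_apply]
  have hcxy : c x = c y := by
    rw [hsn x hx, hsn y hy] at hs
    exact henc hs
  -- Skeleton points have level at least `d`, so none lies between `x` and `y`.
  have hno : ∀ b ∈ β, b < y → b < x := by
    intro b hb hby
    by_contra! hxb
    have hxb' : x < b := lt_of_le_of_ne hxb (by rintro rfl; exact hx hb)
    have := hz b hxb' hby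
    rw [hsβ b hb, hsn x hx] at this
    have := hencd (c x)
    omega
  have hno' : ∀ b ∈ β, x < b → y < b := by
    intro b hb hxb
    by_contra! hby
    rcases hby.eq_or_lt with rfl | hby
    · exact hy hb
    · exact (hno b hb hby).not_gt hxb
  rcases hc x hx with ⟨b, hb, hbx, hbJ, hcx⟩ | ⟨b, hb, hbx, hbJ, hcx⟩ <;>
    rcases hc y hy with ⟨b', hb', hby, hbJ', hcy⟩ | ⟨b', hb', hby, hbJ', hcy⟩
  · rw [hcx]
    have hb'x := hno b' hb' hby
    -- Two different anchors on the same side would have a mutual label in J, being a factor of a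
    -- label in J.
    have hbb : b = b' := by
      have h1 := hsub b' b' x y le_rfl hb'x hxy.le hbJ'
      rcases lt_trichotomy b b' with h | h | h
      · exact absurd (hsub b b b' x le_rfl h hb'x.le hbJ) (hβ _ hb _ hb' h)
      · exact h
      · exact absurd (hsub b' b' b x le_rfl h hbx.le h1) (hβ _ hb' _ hb h)
    subst hbb
    have hw : f x y ∈ J := hsub b x y y hbx.le hxy le_rfl hbJ'
    have hu : f b x = f b y := by
      have := hcx.symm.trans (hcxy.trans hcy)
      simp only [Prod.mk.injEq] at this
      exact this.2.1
    have huw : f b x * f x y = f b x := by rw [hadd b x y hbx hxy, hu]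
    obtain ⟨y', hy', hyJ', hv⟩ := hvR x y hxy hw
    refine (hgu _ _ _ ⟨huw, ?_, ?_, ?_⟩).symm
    · obtain ⟨p, hp⟩ := exists_left_mul_eq_self (w := f x y) (c := f b x)
        (by rw [huw]; exact hJJ _ hw _ hbJ)
      exact ⟨p, by rw [huw] at hp; exact hp⟩
    · rw [hv]; exact hR _ _ _ hxy hy' hw hyJ'
    · rw [hv]; exact hR _ _ _ hy' hxy hyJ' hw
  · rw [hcx, hcy] at hcxy; simp at hcxy
  · rw [hcx, hcy] at hcxy; simp at hcxy
  · rw [hcxy, hcy]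
    have hyb := hno' b hb hbx
    have hbb : b = b' := by
      have h1 := hsub x y b b hxy.le hyb le_rfl hbJ
      rcases lt_trichotomy b b' with h | h | h
      · exact absurd (hsub y b b' b' hyb.le h le_rfl hbJ') (hβ _ hb _ hb' h)
      · exact h
      · exact absurd (hsub y b' b b hby.le h le_rfl h1) (hβ _ hb' _ hb h)
    subst hbb
    have hw : f x y ∈ J := hsub x x y b le_rfl hxy hyb.le hbJ
    have hu : f x b = f y b := by
      have := hcx.symm.trans (hcxy.trans hcy)
      simp only [Prod.mk.injEq] at this
      exact this.2.1
    have huw : f x y * f y b = f y b := by rw [hadd x y b hxy hyb, hu]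
    obtain ⟨x', hx', hxJ', hv⟩ := hvL x y hxy hw
    refine (hgd _ _ _ ⟨huw, ?_, ?_, ?_⟩).symm
    · obtain ⟨p, hp⟩ := exists_right_mul_eq_self (w := f x y) (c := f y b)
        (by rw [huw]; exact hJJ _ hw _ hbJ')
      exact ⟨p, by rw [huw] at hp; exact hp⟩
    · rw [hv]; exact hL _ _ _ hxy hx' hw hxJ'
    · rw [hv]; exact hL _ _ _ hx' hxy hxJ' hw

/-- Every labelling by a finite monoid `M` has a split into at most `2 |M|³ + 1` levels, whose
values do not depend on the labelling. -/
theorem exists_split (M : Type*) [Monoid M] [Finite M] : ∃ e : ℕ → M,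
    ∀ (α : Type*) [LinearOrder α] (f : α → α → M),
      (∀ x y z, x < y → y < z → f x y * f y z = f x z) →
      ∃ s : α → ℕ, (∀ x, s x < 2 * Nat.card M ^ 3 + 1) ∧ IsSplit f e s := by
  classical
  have := Fintype.ofFinite M
  obtain ⟨e, he⟩ := exists_split_aux _ (Finset.univ : Finset M) rfl
  refine ⟨e, fun α _ f hf => ?_⟩
  obtain ⟨s, hs, hsplit⟩ := he α f hf (fun _ _ _ => Finset.mem_univ _)
  refine ⟨s, fun x => Nat.lt_succ_of_le ((hs x).trans_eq ?_), hsplit⟩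
  rw [Finset.card_univ, ← Nat.card_eq_fintype_card]
  ring

end Split

/-! ### Recovering labels from a split. -/

section Segments

variable {α M : Type*} [LinearOrder α] [Monoid M]

/-- `l` is a limit from the right of points of level `k`, and the point `c` of level `k` is above
`l` with no higher level in between. -/
def IsRightLimit (s : α → ℕ) (k : ℕ) (l c : α) : Prop :=
  l < c ∧ s c = k ∧ (∀ z, l < z → z < c → s z ≤ k) ∧ ∀ d, l < d → ∃ z, l < z ∧ z < d ∧ s z = k

/-- `l` is a limit from the left of points of level `k`, and the point `c` of level `k` is below
`l` with no higher level in between. -/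
def IsLeftLimit (s : α → ℕ) (k : ℕ) (l c : α) : Prop :=
  c < l ∧ s c = k ∧ (∀ z, c < z → z < l → s z ≤ k) ∧ ∀ d, d < l → ∃ z, d < z ∧ z < l ∧ s z = k

/-- Points of level k accumulate at `l`, so three of them show that e k is idempotent. For d of
level k close to `l`, both labels are then f l d · e k. -/
theorem IsRightLimit.label_eq {f : α → α → M}
    (hf : ∀ x y z, x < y → y < z → f x y * f y z = f x z) {e : ℕ → M} {s : α → ℕ}
    (hs : IsSplit f e s) {k k' : ℕ} {l c c' : α} (h : IsRightLimit s k l c)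
    (h' : IsRightLimit s k' l c') : f l c = f l c' := by
  -- Points of each level occur arbitrarily close to `l`, hence below the other endpoint, where that
  -- endpoint's level is an upper bound.
  have hkk : k = k' := by
    obtain ⟨z, h1, h2, h3⟩ := h.2.2.2 c' h'.1
    obtain ⟨z', h1', h2', h3'⟩ := h'.2.2.2 c h.1
    exact le_antisymm (h3 ▸ h'.2.2.1 z h1 h2) (h3' ▸ h.2.2.1 z' h1' h2')
  subst hkk
  wlog hcc : c < c' generalizing c c'
  · rcases (not_lt.1 hcc).eq_or_lt with rfl | hlt
    · rfl
    · exact (this h' h hlt).symm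
  obtain ⟨hlc, hsc, -, hlim⟩ := h
  obtain ⟨-, hsc', hle, -⟩ := h'
  obtain ⟨d, hld, hdc, hsd⟩ := hlim c hlc
  obtain ⟨d', hld', hdd', hsd'⟩ := hlim d hld
  have key : ∀ x y, l < x → x < y → y ≤ c' → s x = k → s y = k → f x y = e k := by
    intro x y hlx hxy hy hx hy'
    rw [← hx]
    exact hs x y hxy (hx.trans hy'.symm) fun z hz hz' =>
      hx ▸ hle z (hlx.trans hz) (hz'.trans_le hy)
  have hee : e k * e k = e k := by
    have := hf d' d c hdd' hdc
    rwa [key d' d hld' hdd' (hdc.trans hcc).le hsd' hsd, key d c hld hdc hcc.le hsd hsc,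
      key d' c hld' (hdd'.trans hdc) hcc.le hsd' hsc] at this
  rw [← hf l c c' hlc hcc, ← hf l d c hld hdc, key c c' hlc hcc le_rfl hsc hsc',
    key d c hld hdc hcc.le hsd hsc, mul_assoc, hee]

theorem IsLeftLimit.label_eq {f : α → α → M}
    (hf : ∀ x y z, x < y → y < z → f x y * f y z = f x z) {e : ℕ → M} {s : α → ℕ}
    (hs : IsSplit f e s) {k k' : ℕ} {l c c' : α} (h : IsLeftLimit s k l c)
    (h' : IsLeftLimit s k' l c') : f c l = f c' l := by
  have hkk : k = k' := by
    obtain ⟨z, h1, h2, h3⟩ := h.2.2.2 c' h'.1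
    obtain ⟨z', h1', h2', h3'⟩ := h'.2.2.2 c h.1
    exact le_antisymm (h3 ▸ h'.2.2.1 z h1 h2) (h3' ▸ h.2.2.1 z' h1' h2')
  subst hkk
  wlog hcc : c' < c generalizing c c'
  · rcases (not_lt.1 hcc).eq_or_lt with rfl | hlt
    · rfl
    · exact (this h' h hlt).symm
  obtain ⟨hlc, hsc, -, hlim⟩ := h
  obtain ⟨-, hsc', hle, -⟩ := h'
  obtain ⟨d, hcd, hdl, hsd⟩ := hlim c hlc
  obtain ⟨d', hdd', hdl', hsd'⟩ := hlim d hdl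
  have key : ∀ x y, c' ≤ x → x < y → y < l → s x = k → s y = k → f x y = e k := by
    intro x y hcx hxy hy hx hy'
    rw [← hx]
    exact hs x y hxy (hx.trans hy'.symm) fun z hz hz' =>
      hx ▸ hle z (hcx.trans_lt hz) (hz'.trans hy)
  have hee : e k * e k = e k := by
    have := hf c d d' hcd hdd'
    rwa [key d d' (hcc.trans hcd).le hdd' hdl' hsd hsd', key c d hcc.le hcd hdl hsc hsd,
      key c d' hcc.le (hcd.trans hdd') hdl' hsc hsd'] at this
  rw [← hf c' c l hcc hlc, ← hf c d l hcd hdl, key c' c le_rfl hcc hlc hsc' hsc,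
    key c d hcc.le hcd hdl hsc hsd, ← mul_assoc, hee]

/-- A point with a successor is not a right limit, so one function can serve both cases. Only the
right side needs successors: a segment without inner points is read at its left end. -/
theorem exists_right_label {f : α → α → M}
    (hf : ∀ x y z, x < y → y < z → f x y * f y z = f x z) {e : ℕ → M} {s : α → ℕ}
    (hs : IsSplit f e s) : ∃ R : α → M, (∀ x y, x ⋖ y → R x = f x y) ∧
      ∀ k l c, IsRightLimit s k l c → R l = f l c := by
  have : ∀ x, ∃ m, (∀ y, x ⋖ y → m = f x y) ∧ ∀ k c, IsRightLimit s k x c → m = f x c := by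
    intro x
    by_cases h : ∃ y, x ⋖ y
    · obtain ⟨y, hy⟩ := h
      refine ⟨f x y, fun y' hy' => by rw [hy.unique_right hy'], fun k c hc => ?_⟩
      obtain ⟨z, h1, h2, -⟩ := hc.2.2.2 y hy.1
      exact absurd h2 (hy.2 h1)
    · by_cases h' : ∃ k c, IsRightLimit s k x c
      · obtain ⟨k, c, hc⟩ := h'
        exact ⟨f x c, fun y hy => absurd ⟨y, hy⟩ h, fun k' c' hc' => hc.label_eq hf hs hc'⟩
      · exact ⟨1, fun y hy => absurd ⟨y, hy⟩ h, fun k c hc => absurd ⟨k, c, hc⟩ h'⟩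
  choose R hR using this
  exact ⟨R, fun x y => (hR x).1 y, fun k l c => (hR l).2 k c⟩

theorem exists_left_label {f : α → α → M}
    (hf : ∀ x y z, x < y → y < z → f x y * f y z = f x z) {e : ℕ → M} {s : α → ℕ}
    (hs : IsSplit f e s) : ∃ L : α → M, ∀ k l c, IsLeftLimit s k l c → L l = f c l := by
  have : ∀ x, ∃ m, ∀ k c, IsLeftLimit s k x c → m = f c x := by
    intro x
    by_cases h' : ∃ k c, IsLeftLimit s k x c
    · obtain ⟨k, c, hc⟩ := h'
      exact ⟨f c x, fun k' c' hc' => hc.label_eq hf hs hc'⟩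
    · exact ⟨1, fun k c hc => absurd ⟨k, c, hc⟩ h'⟩
  choose L hL using this
  exact ⟨L, fun k l c => hL l k c⟩

/-- Extension of a relation to the degenerate segments, whose value is `1`. -/
def WeakSegment (V : M → α → α → Prop) (p : M) (x y : α) : Prop :=
  (x = y ∧ p = 1) ∨ (x < y ∧ V p x y)

/-- The segment from `x` to the point `c` of level `k` has value `p`, either because `V` says so
and `c` is the first point of its level, or because `V` gives the value up to the infimum of the
points of level `k`. -/
def HeadSegment (s : α → ℕ) (R : α → M) (V : M → α → α → Prop) (k : ℕ) (p : M) (x c : α) : Prop :=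
  (V p x c ∧ ∀ z, x < z → z < c → s z < k) ∨
  ∃ l, IsRightLimit s k l c ∧ (∀ z, x < z → z < l → s z < k) ∧ ∃ p', WeakSegment V p' x l ∧
    p = p' * R l

/-- The mirror image of `HeadSegment`. -/
def TailSegment (s : α → ℕ) (L : α → M) (V : M → α → α → Prop) (k : ℕ) (q : M) (c y : α) : Prop :=
  (V q c y ∧ ∀ z, c < z → z < y → s z < k) ∨
  ∃ l, IsLeftLimit s k l c ∧ (∀ z, l < z → z < y → s z < k) ∧ ∃ q', WeakSegment V q' l y ∧
    q = L l * q'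

/-- Evaluation of the label of a segment all of whose inner levels are below a bound, by recursion
on this bound. -/
def SegmentValue (s : α → ℕ) (R L : α → M) (e : ℕ → M) : ℕ → M → α → α → Prop
  | 0, a, x, _ => R x = a
  | k + 1, a, x, y =>
    (SegmentValue s R L e k a x y ∧ ∀ z, x < z → z < y → s z < k) ∨
    ∃ c c', x < c ∧ c' < y ∧ s c = k ∧ s c' = k ∧ ∃ p q,
      HeadSegment s R (SegmentValue s R L e k) k p x c ∧
      TailSegment s L (SegmentValue s R L e k) k q c' y ∧
      ((c = c' ∧ a = p * q) ∨ (c < c' ∧ a = p * e k * q))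

/-- Any witnesses of `SegmentValue` compute the true label, by additivity and the split property;
completeness is needed only for their existence. -/
theorem segmentValue_iff (hα : IsCompleteOrdering α) {f : α → α → M}
    (hf : ∀ x y z, x < y → y < z → f x y * f y z = f x z) {e : ℕ → M} {s : α → ℕ}
    (hs : IsSplit f e s) {R L : α → M} (hR : ∀ x y, x ⋖ y → R x = f x y)
    (hR' : ∀ k l c, IsRightLimit s k l c → R l = f l c)
    (hL' : ∀ k l c, IsLeftLimit s k l c → L l = f c l) (k : ℕ) :
    ∀ a x y, x < y → (∀ z, x < z → z < y → s z < k) →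
      (SegmentValue s R L e k a x y ↔ f x y = a) := by
  induction k with
  | zero =>
    intro a x y hxy h
    rw [SegmentValue, hR x y ⟨hxy, fun z hz hz' => Nat.not_lt_zero _ (h z hz hz')⟩]
  | succ k ih =>
    intro a x y hxy h
    set V := SegmentValue s R L e k with hV
    have hhead : ∀ c, x < c → c < y → s c = k → ∀ p, HeadSegment s R V k p x c → f x c = p := by
      rintro c hxc hcy hsc p (⟨hp, hlt⟩ | ⟨l, hl, hlt, p', (⟨rfl, rfl⟩ | ⟨hxl, hp'⟩), rfl⟩)
      · exact (ih p x c hxc hlt).1 hp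
      · rw [hR' _ _ _ hl, one_mul]
      · rw [hR' _ _ _ hl, ← (ih p' x l hxl hlt).1 hp', hf x l c hxl hl.1]
    have htail : ∀ c, x < c → c < y → s c = k → ∀ q, TailSegment s L V k q c y → f c y = q := by
      rintro c hxc hcy hsc p (⟨hp, hlt⟩ | ⟨l, hl, hlt, p', (⟨rfl, rfl⟩ | ⟨hxl, hp'⟩), rfl⟩)
      · exact (ih p c y hcy hlt).1 hp
      · rw [hL' _ _ _ hl, mul_one]
      · rw [hL' _ _ _ hl, ← (ih p' l y hxl hlt).1 hp', hf c l y hl.1 hxl]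
    have hle : ∀ z, x < z → z < y → s z ≤ k := fun z h1 h2 => Nat.lt_succ_iff.1 (h z h1 h2)
    rw [SegmentValue]
    constructor
    · rintro (⟨hV', hlt⟩ | ⟨c, c', hxc, hcy, hsc, hsc', p, q, hp, hq, hcc⟩)
      · exact (ih a x y hxy hlt).1 hV'
      · rcases hcc with ⟨rfl, rfl⟩ | ⟨hcc, rfl⟩
        · rw [← hhead c hxc hcy hsc p hp, ← htail c hxc hcy hsc q hq, hf _ _ _ hxc hcy]
        · rw [← hhead c hxc (hcc.trans hcy) hsc p hp, ← htail c' (hxc.trans hcc) hcy hsc' q hq,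
            ← hsc, ← hs c c' hcc (hsc.trans hsc'.symm) fun z hz hz' =>
              hsc ▸ hle z (hxc.trans hz) (hz'.trans hcy),
            hf _ _ _ hxc hcc, hf _ _ _ (hxc.trans hcc) hcy]
    · rintro rfl
      by_cases hex : ∃ c, x < c ∧ c < y ∧ s c = k
      swap
      · have hlt : ∀ z, x < z → z < y → s z < k := fun z h1 h2 =>
          lt_of_le_of_ne (hle z h1 h2) fun h3 => hex ⟨z, h1, h2, h3⟩
        exact .inl ⟨(ih _ x y hxy hlt).2 rfl, hlt⟩
      right
      obtain ⟨c₀, hxc₀, hcy₀, hsc₀⟩ := hex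
      obtain ⟨c, hxc, hcc₀, hsc, hc⟩ : ∃ c, x < c ∧ c ≤ c₀ ∧ s c = k ∧
          HeadSegment s R V k (f x c) x c := by
        obtain ⟨l, hl⟩ := hα.2 {c | x < c ∧ c < y ∧ s c = k} ⟨c₀, hxc₀, hcy₀, hsc₀⟩
          ⟨x, fun c hc => hc.1.le⟩
        have hxl : x ≤ l := hl.2 fun c hc => hc.1.le
        have hlc₀ : l ≤ c₀ := hl.1 ⟨hxc₀, hcy₀, hsc₀⟩
        have hlt : ∀ z, x < z → z < l → s z < k := fun z h1 h2 =>
          lt_of_le_of_ne (hle z h1 (h2.trans_le (hlc₀.trans hcy₀.le))) fun h3 =>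
            (hl.1 ⟨h1, h2.trans_le (hlc₀.trans hcy₀.le), h3⟩).not_gt h2
        by_cases hmem : x < l ∧ s l = k
        · exact ⟨l, hmem.1, hlc₀, hmem.2, .inl ⟨(ih _ x l hmem.1 hlt).2 rfl, hlt⟩⟩
        -- Here the infimum is not attained inside the segment, so it is a right limit, possibly `x`
        -- itself, and `c₀` serves as the head point.
        · have hlc₀' : l < c₀ := lt_of_le_of_ne hlc₀ (by rintro rfl; exact hmem ⟨hxc₀, hsc₀⟩)
          have hlim : IsRightLimit s k l c₀ := by
            refine ⟨hlc₀', hsc₀, fun z h1 h2 => hle z (hxl.trans_lt h1) (h2.trans hcy₀), ?_⟩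
            intro d hd
            by_contra! hno
            have : d ≤ l := hl.2 fun c hc => by
              by_contra! hcd
              rcases (hl.1 hc).eq_or_lt with rfl | hlc
              · exact hmem ⟨hc.1, hc.2.2⟩
              · exact hno c hlc hcd hc.2.2
            exact this.not_gt hd
          refine ⟨c₀, hxc₀, le_rfl, hsc₀, .inr ⟨l, hlim, hlt, ?_⟩⟩
          rcases hxl.eq_or_lt with rfl | hxl
          · exact ⟨1, .inl ⟨rfl, rfl⟩, by rw [one_mul, hR' _ _ _ hlim]⟩
          · exact ⟨f x l, .inr ⟨hxl, (ih _ x l hxl hlt).2 rfl⟩, by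
              rw [hR' _ _ _ hlim, hf _ _ _ hxl hlc₀']⟩
      obtain ⟨c', hcy', hcc₀', hsc', hc'⟩ : ∃ c, c < y ∧ c₀ ≤ c ∧ s c = k ∧
          TailSegment s L V k (f c y) c y := by
        obtain ⟨l, hl⟩ := hα.1 {c | x < c ∧ c < y ∧ s c = k} ⟨c₀, hxc₀, hcy₀, hsc₀⟩
          ⟨y, fun c hc => hc.2.1.le⟩
        have hly : l ≤ y := hl.2 fun c hc => hc.2.1.le
        have hlc₀ : c₀ ≤ l := hl.1 ⟨hxc₀, hcy₀, hsc₀⟩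
        have hlt : ∀ z, l < z → z < y → s z < k := fun z h1 h2 =>
          lt_of_le_of_ne (hle z ((hxc₀.trans_le hlc₀).trans h1) h2) fun h3 =>
            (hl.1 ⟨(hxc₀.trans_le hlc₀).trans h1, h2, h3⟩).not_gt h1
        by_cases hmem : l < y ∧ s l = k
        · exact ⟨l, hmem.1, hlc₀, hmem.2, .inl ⟨(ih _ l y hmem.1 hlt).2 rfl, hlt⟩⟩
        · have hlc₀' : c₀ < l := lt_of_le_of_ne hlc₀ (by rintro rfl; exact hmem ⟨hcy₀, hsc₀⟩)
          have hlim : IsLeftLimit s k l c₀ := by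
            refine ⟨hlc₀', hsc₀, fun z h1 h2 => hle z (hxc₀.trans h1) (h2.trans_le hly), ?_⟩
            intro d hd
            by_contra! hno
            have : l ≤ d := hl.2 fun c hc => by
              by_contra! hcd
              rcases (hl.1 hc).eq_or_lt with rfl | hlc
              · exact hmem ⟨hc.2.1, hc.2.2⟩
              · exact hno c hcd hlc hc.2.2
            exact this.not_gt hd
          refine ⟨c₀, hcy₀, le_rfl, hsc₀, .inr ⟨l, hlim, hlt, ?_⟩⟩
          rcases hly.eq_or_lt with rfl | hly
          · exact ⟨1, .inl ⟨rfl, rfl⟩, by rw [mul_one, hL' _ _ _ hlim]⟩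
          · exact ⟨f l y, .inr ⟨hly, (ih _ l y hly hlt).2 rfl⟩, by
              rw [hL' _ _ _ hlim, hf _ _ _ hlc₀' hly]⟩
      refine ⟨c, c', hxc, hcy', hsc, hsc', _, _, hc, hc', ?_⟩
      rcases (hcc₀.trans hcc₀').eq_or_lt with rfl | hcc
      · exact .inl ⟨rfl, (hf _ _ _ hxc hcy').symm⟩
      · refine .inr ⟨hcc, ?_⟩
        rw [← hsc, ← hs c c' hcc (hsc.trans hsc'.symm) fun z hz hz' =>
              hsc ▸ hle z (hxc.trans hz) (hz'.trans hcy'),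
            hf _ _ _ hxc hcc, hf _ _ _ (hxc.trans hcc) hcy']

end Segments

/-! ### First-order definability of the recursion. -/

section Formulas

variable {N : ℕ} {γ : Type} {α : Type*} [LinearOrder α]

/-- Satisfaction of a formula in `(α, X₁, …, X_N)` under a valuation of its variables. -/
def Satisfies (X : Fin N → Set α) (φ : (labelledOrderLanguage N).Formula γ) (v : γ → α) : Prop :=
  @Language.Formula.Realize (labelledOrderLanguage N) α (labelledOrderStructure X) γ φ v

namespace LabelledOrder

/-- The atomic formula `i < j`. -/
def ltFormula (i j : γ) : (labelledOrderLanguage N).Formula γ :=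
  Language.Relations.formula₂ (L := labelledOrderLanguage N) LabelledOrderRel.lt
    (Language.Term.var i) (Language.Term.var j)

/-- The atomic formula `i = j`. -/
def eqFormula (i j : γ) : (labelledOrderLanguage N).Formula γ :=
  Language.Term.equal (Language.Term.var i) (Language.Term.var j)

/-- The atomic formula `p_n i`. -/
def predFormula (n : Fin N) (i : γ) : (labelledOrderLanguage N).Formula γ :=
  Language.Relations.formula₁ (L := labelledOrderLanguage N) (LabelledOrderRel.pred n)
    (Language.Term.var i)

open Classical in
/-- A closed formula with a prescribed truth value. -/
noncomputable def constFormula (P : Prop) : (labelledOrderLanguage N).Formula γ :=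
  if P then ⊤ else ⊥

/-- Existential quantification over one variable. -/
noncomputable def exFormula (φ : (labelledOrderLanguage N).Formula (γ ⊕ Unit)) :
    (labelledOrderLanguage N).Formula γ :=
  φ.iExs Unit

variable {X : Fin N → Set α} {v : γ → α}

@[simp]
theorem satisfies_lt (i j : γ) : Satisfies X (ltFormula i j) v ↔ v i < v j := by
  let _ := labelledOrderStructure X
  exact Language.Formula.realize_rel₂

@[simp]
theorem satisfies_eq (i j : γ) :
    Satisfies X (eqFormula i j : (labelledOrderLanguage N).Formula γ) v ↔ v i = v j := by
  let _ := labelledOrderStructure X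
  exact Language.Formula.realize_equal

@[simp]
theorem satisfies_pred (n : Fin N) (i : γ) : Satisfies X (predFormula n i) v ↔ v i ∈ X n := by
  let _ := labelledOrderStructure X
  exact Language.Formula.realize_rel₁

@[simp]
theorem satisfies_const (P : Prop) :
    Satisfies X (constFormula P : (labelledOrderLanguage N).Formula γ) v ↔ P := by
  let _ := labelledOrderStructure X
  unfold constFormula Satisfies
  split_ifs with h <;> simp [h, Language.Formula.Realize]

@[simp]
theorem satisfies_not (φ : (labelledOrderLanguage N).Formula γ) :
    Satisfies X φ.not v ↔ ¬Satisfies X φ v := Iff.rfl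

@[simp]
theorem satisfies_inf (φ ψ : (labelledOrderLanguage N).Formula γ) :
    Satisfies X (φ ⊓ ψ) v ↔ Satisfies X φ v ∧ Satisfies X ψ v := by
  let _ := labelledOrderStructure X
  exact Language.Formula.realize_inf

@[simp]
theorem satisfies_sup (φ ψ : (labelledOrderLanguage N).Formula γ) :
    Satisfies X (φ ⊔ ψ) v ↔ Satisfies X φ v ∨ Satisfies X ψ v := by
  let _ := labelledOrderStructure X
  exact Language.Formula.realize_sup

@[simp]
theorem satisfies_iSup {β : Type*} [Finite β] (φ : β → (labelledOrderLanguage N).Formula γ) :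
    Satisfies X (Language.Formula.iSup φ) v ↔ ∃ b, Satisfies X (φ b) v := by
  let _ := labelledOrderStructure X
  exact Language.Formula.realize_iSup

@[simp]
theorem satisfies_iInf {β : Type*} [Finite β] (φ : β → (labelledOrderLanguage N).Formula γ) :
    Satisfies X (Language.Formula.iInf φ) v ↔ ∀ b, Satisfies X (φ b) v := by
  let _ := labelledOrderStructure X
  exact Language.Formula.realize_iInf

@[simp]
theorem satisfies_ex (φ : (labelledOrderLanguage N).Formula (γ ⊕ Unit)) :
    Satisfies X (exFormula φ) v ↔ ∃ t, Satisfies X φ (Sum.elim v fun _ => t) := by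
  let _ := labelledOrderStructure X
  refine Language.Formula.realize_iExs.trans ⟨fun ⟨i, hi⟩ => ⟨i (), hi⟩, fun ⟨t, ht⟩ => ⟨_, ht⟩⟩

section Colours

variable {K : Type*} [Finite K] (enc : K → Fin N → Bool)

/-- The colour of `i`, encoded in the unary predicates by `enc`, satisfies `Q`. -/
noncomputable def colourFormula (Q : K → Prop) (i : γ) : (labelledOrderLanguage N).Formula γ :=
  Language.Formula.iSup fun κ : K => constFormula (Q κ) ⊓
    Language.Formula.iInf fun n : Fin N =>
      if enc κ n then predFormula n i else (predFormula n i).not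

/-- All points strictly between `i` and `j` have a colour satisfying `Q`. -/
noncomputable def betweenFormula (Q : K → Prop) (i j : γ) : (labelledOrderLanguage N).Formula γ :=
  (exFormula (ltFormula (.inl i) (.inr ()) ⊓ ltFormula (.inr ()) (.inl j) ⊓
    colourFormula enc (fun κ => ¬Q κ) (.inr ()))).not

variable {enc} {col : α → K}

theorem satisfies_colour (henc : Function.Injective enc) (Q : K → Prop) (i : γ) :
    Satisfies (fun n => {x | enc (col x) n = true}) (colourFormula enc Q i) v ↔
      Q (col (v i)) := by
  have h : ∀ (κ : K) (n : Fin N),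
      Satisfies (fun n => {x | enc (col x) n = true})
        (if enc κ n then predFormula n i else (predFormula n i).not) v ↔
      enc (col (v i)) n = enc κ n := by
    intro κ n
    cases hκ : enc κ n <;> simp
  simp only [colourFormula, satisfies_iSup, satisfies_inf, satisfies_const, satisfies_iInf, h,
    ← funext_iff, henc.eq_iff]
  simp

theorem satisfies_between (henc : Function.Injective enc) (Q : K → Prop) (i j : γ) :
    Satisfies (fun n => {x | enc (col x) n = true}) (betweenFormula enc Q i j) v ↔
      ∀ z, v i < z → z < v j → Q (col z) := by
  simp [betweenFormula, satisfies_colour henc]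

end Colours

section Segments

variable {M : Type*} [Monoid M] [Finite M] {h : ℕ} (enc : Fin h × M × M → Fin N → Bool)

/-- The formula expressing `IsRightLimit`. -/
noncomputable def rightLimitFormula (k : ℕ) (l c : γ) : (labelledOrderLanguage N).Formula γ :=
  ltFormula l c ⊓ colourFormula enc (fun κ => (κ.1 : ℕ) = k) c ⊓
    betweenFormula enc (fun κ => (κ.1 : ℕ) ≤ k) l c ⊓
    (exFormula (ltFormula (.inl l) (.inr ()) ⊓
      betweenFormula enc (fun κ => (κ.1 : ℕ) ≠ k) (.inl l) (.inr ()))).not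

/-- The formula expressing `IsLeftLimit`. -/
noncomputable def leftLimitFormula (k : ℕ) (l c : γ) : (labelledOrderLanguage N).Formula γ :=
  ltFormula c l ⊓ colourFormula enc (fun κ => (κ.1 : ℕ) = k) c ⊓
    betweenFormula enc (fun κ => (κ.1 : ℕ) ≤ k) c l ⊓
    (exFormula (ltFormula (.inr ()) (.inl l) ⊓
      betweenFormula enc (fun κ => (κ.1 : ℕ) ≠ k) (.inr ()) (.inl l))).not

/-- The formula expressing `WeakSegment`. -/
noncomputable def weakSegmentFormula
    (V : M → ∀ γ : Type, γ → γ → (labelledOrderLanguage N).Formula γ) (p : M) (i j : γ) :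
    (labelledOrderLanguage N).Formula γ :=
  (eqFormula i j ⊓ constFormula (p = 1)) ⊔ (ltFormula i j ⊓ V p γ i j)

/-- The formula expressing `HeadSegment`. -/
noncomputable def headSegmentFormula
    (V : M → ∀ γ : Type, γ → γ → (labelledOrderLanguage N).Formula γ) (k : ℕ) (p : M) (i j : γ) :
    (labelledOrderLanguage N).Formula γ :=
  (V p γ i j ⊓ betweenFormula enc (fun κ => (κ.1 : ℕ) < k) i j) ⊔
  exFormula (rightLimitFormula enc k (.inr ()) (.inl j) ⊓
    betweenFormula enc (fun κ => (κ.1 : ℕ) < k) (.inl i) (.inr ()) ⊓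
    Language.Formula.iSup fun p' : M => weakSegmentFormula V p' (.inl i) (.inr ()) ⊓
      colourFormula enc (fun κ => p = p' * κ.2.1) (.inr ()))

/-- The formula expressing `TailSegment`. -/
noncomputable def tailSegmentFormula
    (V : M → ∀ γ : Type, γ → γ → (labelledOrderLanguage N).Formula γ) (k : ℕ) (q : M) (i j : γ) :
    (labelledOrderLanguage N).Formula γ :=
  (V q γ i j ⊓ betweenFormula enc (fun κ => (κ.1 : ℕ) < k) i j) ⊔
  exFormula (leftLimitFormula enc k (.inr ()) (.inl i) ⊓
    betweenFormula enc (fun κ => (κ.1 : ℕ) < k) (.inr ()) (.inl j) ⊓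
    Language.Formula.iSup fun q' : M => weakSegmentFormula V q' (.inr ()) (.inl j) ⊓
      colourFormula enc (fun κ => q = κ.2.2 * q') (.inr ()))

/-- The formula expressing `SegmentValue`. -/
noncomputable def segmentFormula (e : ℕ → M) :
    ℕ → M → ∀ γ : Type, γ → γ → (labelledOrderLanguage N).Formula γ
  | 0, a, _, i, _ => colourFormula enc (fun κ => κ.2.1 = a) i
  | k + 1, a, γ, i, j =>
    (segmentFormula e k a γ i j ⊓ betweenFormula enc (fun κ => (κ.1 : ℕ) < k) i j) ⊔
    exFormula (exFormula (
      ltFormula (.inl (.inl i)) (.inl (.inr ())) ⊓ ltFormula (.inr ()) (.inl (.inl j)) ⊓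
      colourFormula enc (fun κ => (κ.1 : ℕ) = k) (.inl (.inr ())) ⊓
      colourFormula enc (fun κ => (κ.1 : ℕ) = k) (.inr ()) ⊓
      Language.Formula.iSup fun p : M => Language.Formula.iSup fun q : M =>
        headSegmentFormula enc (segmentFormula e k) k p (.inl (.inl i)) (.inl (.inr ())) ⊓
        tailSegmentFormula enc (segmentFormula e k) k q (.inr ()) (.inl (.inl j)) ⊓
        ((eqFormula (.inl (.inr ())) (.inr ()) ⊓ constFormula (a = p * q)) ⊔
          (ltFormula (.inl (.inr ())) (.inr ()) ⊓ constFormula (a = p * e k * q)))))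

variable {enc} {s : α → ℕ} {R L : α → M} {hs : ∀ x, s x < h}

/-- The type of variables is universally quantified because each quantifier adds a variable before
the formula of the previous level is used. -/
theorem satisfies_segment (henc : Function.Injective enc) (e : ℕ → M) (k : ℕ) :
    ∀ (a : M) (γ : Type) (i j : γ) (v : γ → α),
      Satisfies (fun n => {x | enc (⟨s x, hs x⟩, R x, L x) n = true})
        (segmentFormula enc e k a γ i j) v ↔ SegmentValue s R L e k a (v i) (v j) := by
  induction k with
  | zero =>
    intro a γ i j v
    exact satisfies_colour (col := fun x => (⟨s x, hs x⟩, R x, L x)) henc _ _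
  | succ k ih =>
    intro a γ i j v
    have hcol : ∀ (γ : Type) (v : γ → α) (Q : Fin h × M × M → Prop) (i : γ), _ := fun γ v =>
      satisfies_colour (v := v) (col := fun x => (⟨s x, hs x⟩, R x, L x)) henc
    have hbet : ∀ (γ : Type) (v : γ → α) (Q : Fin h × M × M → Prop) (i j : γ), _ := fun γ v =>
      satisfies_between (v := v) (col := fun x => (⟨s x, hs x⟩, R x, L x)) henc
    simp only [segmentFormula, headSegmentFormula, tailSegmentFormula, weakSegmentFormula,
      rightLimitFormula, leftLimitFormula, satisfies_sup, satisfies_inf, satisfies_ex,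
      satisfies_iSup, satisfies_not, satisfies_lt, satisfies_eq, satisfies_const, hcol, hbet, ih,
      SegmentValue, HeadSegment, TailSegment, WeakSegment, IsRightLimit, IsLeftLimit,
      Sum.elim_inl, Sum.elim_inr, not_exists, not_and, not_forall, ne_eq, not_not, exists_prop,
      and_assoc]

end Segments

end LabelledOrder

end Formulas

/-! ### Enough predicates to encode the colours. -/

section Counting

theorem pow_le_two_pow_compactionSize {n : ℕ} (hn : 2 ≤ n) :
    n ^ (6 * n + 2) ≤ 2 ^ compactionSize n := by
  have hn0 : (0 : ℝ) < n := by positivity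
  have h1 : (6 * (n : ℝ) + 2) * Real.logb 2 n ≤ compactionSize n := Nat.le_ceil _
  have h2 : ((n ^ (6 * n + 2) : ℕ) : ℝ) ≤ ((2 ^ compactionSize n : ℕ) : ℝ) := by
    calc ((n ^ (6 * n + 2) : ℕ) : ℝ) = (n : ℝ) ^ (6 * (n : ℝ) + 2) := by
          rw [Nat.cast_pow, ← Real.rpow_natCast]; push_cast; rfl
      _ = (2 : ℝ) ^ ((6 * (n : ℝ) + 2) * Real.logb 2 n) := by
          rw [mul_comm (6 * (n : ℝ) + 2) (Real.logb 2 n), Real.rpow_mul (by norm_num),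
            Real.rpow_logb (by norm_num) (by norm_num) hn0]
      _ ≤ (2 : ℝ) ^ ((compactionSize n : ℕ) : ℝ) :=
          Real.rpow_le_rpow_of_exponent_le (by norm_num) h1
      _ = _ := by rw [Real.rpow_natCast]; push_cast; rfl
  exact_mod_cast h2

/-- The monoid has n + 1 elements because of the adjoined unit. The polynomial count is at most n¹²,
well below the available bound. -/
theorem colour_count_le {n : ℕ} (hn : 2 ≤ n) :
    (2 * (n + 1) ^ 3 + 1) * ((n + 1) * (n + 1)) ≤ 2 ^ compactionSize n := by
  refine le_trans ?_ (pow_le_two_pow_compactionSize hn)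
  have h1 : n + 1 ≤ n ^ 2 := by nlinarith
  have h2 : 1 ≤ n ^ 6 := Nat.one_le_pow _ _ (by omega)
  have h3 : 3 ≤ n ^ 2 := by nlinarith
  calc (2 * (n + 1) ^ 3 + 1) * ((n + 1) * (n + 1))
      ≤ (2 * (n ^ 2) ^ 3 + n ^ 6) * (n ^ 2 * n ^ 2) := by gcongr
    _ = 3 * n ^ 10 := by ring
    _ ≤ n ^ 2 * n ^ 10 := by gcongr
    _ = n ^ 12 := by ring
    _ ≤ n ^ (6 * n + 2) := Nat.pow_le_pow_right (by omega) (by omega)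

end Counting

theorem theorem6p1 (S : Type*) [Semigroup S] [Finite S] :
    ∃ labelling : S → (labelledOrderLanguage (compactionSize (Nat.card S))).Formula (Fin 2),
      ∀ (α : Type*) [LinearOrder α], IsCompleteOrdering α →
        ∀ σ : (∀ x y : α, x < y → S), IsAdditiveLabelling σ →
          ∃ X : Fin (compactionSize (Nat.card S)) → Set α,
            ∀ (a : S) (x y : α) (hxy : x < y),
              σ x y hxy = a ↔ LabelledOrderModels X (labelling a) x y := by
  -- With at most one element there are no predicates, and every label is trivially correct; the
  -- counting needs |S| ≥ 2.
  rcases subsingleton_or_nontrivial S with hS | hS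
  · refine ⟨fun _ => LabelledOrder.constFormula True, fun α _ _ σ _ => ⟨fun _ => ∅, ?_⟩⟩
    intro a x y hxy
    exact iff_of_true (Subsingleton.elim _ _) ((LabelledOrder.satisfies_const True).2 trivial)
  have hM : Finite (WithOne S) := inferInstanceAs (Finite (Option S))
  have hcardM : Nat.card (WithOne S) = Nat.card S + 1 := Finite.card_option
  obtain ⟨e, he⟩ := exists_split (WithOne S)
  set h := 2 * Nat.card (WithOne S) ^ 3 + 1 with hh
  obtain ⟨enc, henc⟩ : ∃ enc : Fin h × WithOne S × WithOne S →
      Fin (compactionSize (Nat.card S)) → Bool, Function.Injective enc := by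
    have := Fintype.ofFinite (WithOne S)
    refine (Function.Embedding.nonempty_of_card_le ?_).elim fun f => ⟨f, f.injective⟩
    rw [Fintype.card_prod, Fintype.card_prod, Fintype.card_fun, Fintype.card_fin, Fintype.card_fin,
      Fintype.card_bool, ← Nat.card_eq_fintype_card, hh, hcardM]
    exact colour_count_le (Finite.one_lt_card_iff_nontrivial.2 hS)
  refine ⟨fun a => LabelledOrder.segmentFormula enc e h (a : WithOne S) (Fin 2) 0 1, ?_⟩
  intro α _ hα σ hσ
  let f : α → α → WithOne S := fun x y => if hxy : x < y then (σ x y hxy : WithOne S) else 1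
  have hfσ : ∀ x y (hxy : x < y), f x y = σ x y hxy := fun x y hxy => dif_pos hxy
  have hf : ∀ x y z, x < y → y < z → f x y * f y z = f x z := fun x y z hxy hyz => by
    rw [hfσ x y hxy, hfσ y z hyz, hfσ x z (hxy.trans hyz), ← hσ x y z hxy hyz, WithOne.coe_mul]
  obtain ⟨s, hsh, hs⟩ := he α f hf
  obtain ⟨R, hR, hR'⟩ := exists_right_label hf hs
  obtain ⟨L, hL'⟩ := exists_left_label hf hs
  refine ⟨fun n => {x | enc (⟨s x, hsh x⟩, R x, L x) n = true}, fun a x y hxy => ?_⟩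
  -- All levels are below `h`, so the recursion started at `h` covers every pair.
  rw [← WithOne.coe_inj, ← hfσ x y hxy,
    ← segmentValue_iff hα hf hs hR hR' hL' h a x y hxy fun z _ _ => hsh z]
  exact (LabelledOrder.satisfies_segment henc e h (a : WithOne S) (Fin 2) 0 1 ![x, y]).symm
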